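/- Let $1\le m\le n$ be integers. Let $V_m$ be the volume of the unit ball of $\mathbb R^m$, let $d\Omega$ be the surface measure (solid angle) on the unit sphere $S^{n-1}\subset\mathbb R^n$, and let $S_{n-1}=\int_{S^{n-1}}d\Omega$. For a Lebesgue measurable set (region) $K\subset\mathbb R^n$ define its average $m$-dimensional thickness $$T_{m,n}(K)=\int_{G(m,n)}\mathrm{vol}_m(K\cap W)\,d\gamma(W)\in[0,\infty],$$ where $G(m,n)$ is the Grassmannian of all $m$-dimensional linear subspaces of $\mathbb R^n$, $\gamma$ is its rotation-invariant probability measure (the image of the normalized Haar measure of $O(n)$ under $g\mapsto gW_0$, $W_0$ the span of the first $m$ coordinate vectors), and $\mathrm{vol}_m$ is the $m$-dimensional Lebesgue measure of the Euclidean space $W$. (a) Let $f:S^{n-1}\to[0,\infty)$ be measurable and let $K_f=\{r u: u\in S^{n-1},\ 0\le r\le f(u)\}$ be the star-shaped region with radial function $f$. Then $W\mapsto\mathrm{vol}_m(K_f\cap W)$ is $\gamma$-almost everywhere measurable and $$T_{m,n}(K_f)=\frac{V_m}{S_{n-1}}\int_{S^{n-1}}f(u)^m\,d\Omega(u).$$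 (b) For every Lebesgue measurable $K\subset\mathbb R^n$, star-shaped or not, $W\mapsto\mathrm{vol}_m(K\cap W)$ is $\gamma$-almost everywhere measurable and $$T_{m,n}(K)=\frac{mV_m}{S_{n-1}}\int_K|x|^{m-n}\,dx .$$ In differential form, $dT_{m,n}=\frac{mV_m}{S_{n-1}}\,r^{m-n}\,dV$: on Lebesgue measurable sets, $T_{m,n}$ is the measure with density $\frac{mV_m}{S_{n-1}}|x|^{m-n}$ with respect to Lebesgue measure, so each volume element contributes in proportion to $r^{m-n}$. All integrals are integrals of nonnegative functions with values in $[0,\infty]$. -/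

import Mathlib

open MeasureTheory Set

noncomputable section

namespace AverageSection

/-- Euclidean space `ℝⁿ` with its Euclidean norm. -/
abbrev Euc (n : ℕ) : Type := EuclideanSpace ℝ (Fin n)

/-- The orthogonal group `O(n)`, as the group of all linear isometries of `ℝⁿ`, with the topology
of the operator norm. -/
abbrev Orth (n : ℕ) : Type := unitary (Euc n →L[ℝ] Euc n)

instance (n : ℕ) : ContinuousStar (Euc n →L[ℝ] Euc n) :=
  ⟨(ContinuousLinearMap.adjoint (𝕜 := ℝ) (E := Euc n) (F := Euc n)).continuous⟩

instance (n : ℕ) : CompactSpace (Orth n) := by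
  refine isCompact_iff_compactSpace.mp (Metric.isCompact_of_isClosed_isBounded isClosed_unitary ?_)
  refine (Metric.isBounded_closedBall (x := (0 : Euc n →L[ℝ] Euc n)) (r := 1)).subset ?_
  intro u hu
  rw [mem_closedBall_zero_iff]
  refine ContinuousLinearMap.opNorm_le_bound _ zero_le_one fun x => ?_
  have h := (Unitary.linearIsometryEquiv (⟨u, hu⟩ : Orth n)).norm_map x
  rw [one_mul]
  exact h.le

/-- The normalized Haar measure of the compact group `O(n)`. -/
def haarOrth (n : ℕ) : Measure (Orth n) := Measure.haarMeasure ⊤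

instance (n : ℕ) : IsProbabilityMeasure (haarOrth n) :=
  ⟨by simpa [haarOrth] using Measure.haarMeasure_self (G := Orth n) (K₀ := ⊤)⟩

instance (n : ℕ) : (haarOrth n).IsMulLeftInvariant := by
  unfold haarOrth; infer_instance

/-- The Grassmannian of all `m`-dimensional linear subspaces of `ℝⁿ`. -/
def Gr (m n : ℕ) : Type := {W : Submodule ℝ (Euc n) // Module.finrank ℝ W = m}

/-- The Borel structure of the Grassmannian: a subspace is identified with the orthogonal
projection onto it. -/
instance (m n : ℕ) : MeasurableSpace (Gr m n) :=
  MeasurableSpace.comap (fun W : Gr m n => W.1.starProjection)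
    (inferInstance : MeasurableSpace (Euc n →L[ℝ] Euc n))

/-- The image `g W` of a subspace `W` under an orthogonal map `g`. -/
def rotate {m n : ℕ} (g : Orth n) (W : Gr m n) : Gr m n :=
  ⟨W.1.map (Unitary.linearIsometryEquiv g).toLinearEquiv.toLinearMap, by
    rw [LinearEquiv.finrank_map_eq]; exact W.2⟩

/-- The span of the first `m` coordinate vectors of `ℝⁿ`. -/
def coordSubspace {m n : ℕ} (h : m ≤ n) : Gr m n :=
  ⟨Submodule.span ℝ (range fun i : Fin m => EuclideanSpace.single (Fin.castLE h i) (1 : ℝ)), by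
    have hb : LinearIndependent ℝ
        fun i : Fin m => EuclideanSpace.single (Fin.castLE h i) (1 : ℝ) := by
      have := (EuclideanSpace.basisFun (Fin n) ℝ).toBasis.linearIndependent.comp
        (Fin.castLE h) (Fin.castLE_injective h)
      have e : (fun i : Fin m => EuclideanSpace.single (Fin.castLE h i) (1 : ℝ)) =
          (EuclideanSpace.basisFun (Fin n) ℝ).toBasis ∘ Fin.castLE h := by
        funext i; simp
      rw [e]
      exact this
    rw [finrank_span_eq_card hb, Fintype.card_fin]⟩

/-- The uniform (rotation invariant) probability measure on the Grassmannian: the law of `g W₀`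
when `g` is distributed according to the Haar probability measure of `O(n)`. -/
def uniformGr {m n : ℕ} (h : m ≤ n) : Measure (Gr m n) :=
  (haarOrth n).map fun g => rotate g (coordSubspace h)

theorem starProjection_rotate {m n : ℕ} (g : Orth n) (W : Gr m n) :
    (rotate g W).1.starProjection =
      (g : Euc n →L[ℝ] Euc n) * W.1.starProjection * star (g : Euc n →L[ℝ] Euc n) := by
  ext1 x
  have h := Submodule.starProjection_map_apply (Unitary.linearIsometryEquiv g) W.1 x
  exact h

theorem measurable_orbit {m n : ℕ} (W : Gr m n) : Measurable fun g : Orth n => rotate g W := by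
  refine measurable_comap_iff.mpr ?_
  refine Continuous.measurable ?_
  simp only [Function.comp_def, starProjection_rotate]
  fun_prop

theorem measurable_rotate {m n : ℕ} (g : Orth n) :
    Measurable (rotate g : Gr m n → Gr m n) := by
  refine measurable_comap_iff.mpr ?_
  simp only [Function.comp_def, starProjection_rotate]
  have h : Continuous fun P : Euc n →L[ℝ] Euc n =>
    (g : Euc n →L[ℝ] Euc n) * P * star (g : Euc n →L[ℝ] Euc n) := by fun_prop
  exact h.measurable.comp (comap_measurable _)

instance {m n : ℕ} (h : m ≤ n) : IsProbabilityMeasure (uniformGr h) :=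
  Measure.isProbabilityMeasure_map (measurable_orbit _).aemeasurable

/-- The uniform measure is invariant under all orthogonal maps. -/
theorem map_rotate_uniformGr {m n : ℕ} (h : m ≤ n) (u : Orth n) :
    (uniformGr h).map (rotate u) = uniformGr h := by
  have key : (rotate u : Gr m n → Gr m n) ∘ (fun g => rotate g (coordSubspace h)) =
      (fun g => rotate g (coordSubspace h)) ∘ fun g => u * g := by
    funext g
    apply Subtype.ext
    exact (Submodule.map_comp (Unitary.linearIsometryEquiv g).toLinearEquiv.toLinearMap
      (Unitary.linearIsometryEquiv u).toLinearEquiv.toLinearMap (coordSubspace h).1).symm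
  unfold uniformGr
  rw [Measure.map_map (measurable_rotate u) (measurable_orbit _), key,
    ← Measure.map_map (measurable_orbit _) (measurable_const_mul u), map_mul_left_eq_self]

/-- The `m`-dimensional volume of the section `K ∩ W`, computed in the Euclidean space `W`. -/
def sectionVolume {m n : ℕ} (K : Set (Euc n)) (W : Gr m n) : ENNReal :=
  (volume : Measure W.1) {w : W.1 | (w : Euc n) ∈ K}

/-- The average `m`-dimensional thickness `T(m, n)` of `K`: the average of the `m`-volume of
`K ∩ W` over all `m`-dimensional linear subspaces `W`. -/
def thickness {m n : ℕ} (h : m ≤ n) (K : Set (Euc n)) : ENNReal :=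
  ∫⁻ W : Gr m n, sectionVolume K W ∂(uniformGr h)

/-- The unit sphere of `ℝⁿ`. -/
abbrev USphere (n : ℕ) : Type := Metric.sphere (0 : Euc n) 1

/-- The solid angle (surface measure) `dΩ` on the unit sphere of `ℝⁿ`. -/
def solidAngle (n : ℕ) : Measure (USphere n) := (volume : Measure (Euc n)).toSphere

/-- `V_m`, the volume of the unit ball of `ℝᵐ`. -/
def ballVol (m : ℕ) : ENNReal := volume (Metric.ball (0 : Euc m) 1)

/-- `S_{n-1}`, the surface area of the unit sphere of `ℝⁿ`. -/
def sphereArea (n : ℕ) : ENNReal := solidAngle n univ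

/-- The region that is star-shaped about the origin with radial function `f`. -/
def starRegion {n : ℕ} (f : USphere n → ℝ) : Set (Euc n) :=
  {x | ∃ (u : USphere n) (r : ℝ), 0 ≤ r ∧ r ≤ f u ∧ x = r • (u : Euc n)}

end AverageSection

end

namespace AverageSection

/-! Averaging over subspaces is averaging over rotations `g` of one fixed subspace. By Tonelli, the
thickness of a Borel set `K` is the integral over that subspace of `hitProb K`, the probability that
a random rotation carries a point into `K`. This depends only on the norm (`hitProb_congr`), say as
`φ r`, so in polar coordinates the thickness is `S_{m-1} ∫ r^(m-1) φ r dr`. Rotation invariance of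
Lebesgue measure gives `∫_K |x|^(m-n) dx = ∫ |x|^(m-n) hitProb K x dx = S_{n-1} ∫ r^(m-1) φ r dr`.
The radial integrals agree, and `S_{m-1} = m V_m` gives (b). Null sets then have null sections for
almost every subspace, which extends (b) to Lebesgue measurable sets. Part (a) is (b) in polar
coordinates, as `m ∫_0^f r^(m-1) dr = f^m`. -/

/-- Integration in polar coordinates for nonnegative functions. -/
theorem lintegral_eq_lintegral_toSphere {E : Type*} [NormedAddCommGroup E] [NormedSpace ℝ E]
    [MeasurableSpace E] [BorelSpace E] [FiniteDimensional ℝ E] [Nontrivial E] (μ : Measure E)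
    [μ.IsAddHaarMeasure] {F : E → ENNReal} (hF : AEMeasurable F μ) :
    ∫⁻ x, F x ∂μ = ∫⁻ u, ∫⁻ r in Ioi (0 : ℝ),
      ENNReal.ofReal (r ^ (Module.finrank ℝ E - 1)) * F (r • (u : E)) ∂volume ∂μ.toSphere := by
  have hmp := μ.measurePreserving_homeomorphUnitSphereProd
  have hemb := (homeomorphUnitSphereProd E).measurableEmbedding
  set G : Metric.sphere (0 : E) 1 × Ioi (0 : ℝ) → ENNReal := fun p => F (p.2.1 • (p.1 : E)) with hG
  have hGF : ∀ x : ({0}ᶜ : Set E), G (homeomorphUnitSphereProd E x) = F x := fun x => by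
    have hx : ‖(x : E)‖ ≠ 0 := norm_ne_zero_iff.mpr x.2
    simp [hG, homeomorphUnitSphereProd, smul_smul, hx]
  have hGm : AEMeasurable G (μ.toSphere.prod (Measure.volumeIoiPow (Module.finrank ℝ E - 1))) := by
    rw [← hmp.map_eq, hemb.aemeasurable_map_iff]
    have : G ∘ homeomorphUnitSphereProd E = F ∘ Subtype.val := funext hGF
    rw [this]
    refine AEMeasurable.comp_measurable ?_ measurable_subtype_coe
    rw [map_comap_subtype_coe (measurableSet_singleton _).compl]
    exact hF.restrict
  calc
    ∫⁻ x, F x ∂μ = ∫⁻ x : ({0}ᶜ : Set E), F x ∂(μ.comap (↑)) := by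
      rw [lintegral_subtype_comap (measurableSet_singleton _).compl, restrict_compl_singleton]
    _ = ∫⁻ p, G p ∂(μ.toSphere.prod (Measure.volumeIoiPow (Module.finrank ℝ E - 1))) := by
      rw [← hmp.lintegral_comp_emb hemb]
      simp only [hGF]
    _ = ∫⁻ u, ∫⁻ r, G (u, r) ∂(Measure.volumeIoiPow (Module.finrank ℝ E - 1)) ∂μ.toSphere :=
      lintegral_prod _ hGm
    _ = _ := by
      refine lintegral_congr fun u => ?_
      -- `F` is only a.e. measurable, so its restriction to a given ray need not be measurable;
      -- finiteness of the density suffices.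
      rw [Measure.volumeIoiPow, lintegral_withDensity_eq_lintegral_mul_non_measurable _ (by fun_prop)
        (Filter.Eventually.of_forall fun _ => ENNReal.ofReal_lt_top),
        ← lintegral_subtype_comap measurableSet_Ioi]
      rfl

/-- The integral of a nonnegative radial function. -/
theorem lintegral_fun_norm {E : Type*} [NormedAddCommGroup E] [NormedSpace ℝ E]
    [MeasurableSpace E] [BorelSpace E] [FiniteDimensional ℝ E] [Nontrivial E] (μ : Measure E)
    [μ.IsAddHaarMeasure] {φ : ℝ → ENNReal} (hφ : Measurable φ) :
    ∫⁻ x, φ ‖x‖ ∂μ = μ.toSphere univ * ∫⁻ r in Ioi (0 : ℝ),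
      ENNReal.ofReal (r ^ (Module.finrank ℝ E - 1)) * φ r := by
  rw [lintegral_eq_lintegral_toSphere μ (F := fun x => φ ‖x‖) (by fun_prop), mul_comm,
    ← lintegral_const]
  refine lintegral_congr fun u => setLIntegral_congr_fun measurableSet_Ioi fun r hr => ?_
  have hu : ‖(u : E)‖ = 1 := by simp
  simp only [norm_smul, hu, mul_one, Real.norm_of_nonneg (le_of_lt hr)]

/-! ### The orthogonal group and its action -/

instance (n : ℕ) : PolishSpace (Orth n) :=
  (isClosed_unitary (R := Euc n →L[ℝ] Euc n)).polishSpace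

instance (n : ℕ) : (haarOrth n).IsHaarMeasure := by
  unfold haarOrth; infer_instance

/-- A right translate is again a Haar probability measure, and that is unique. -/
instance (n : ℕ) : (haarOrth n).IsMulRightInvariant := by
  refine ⟨fun h => ?_⟩
  have : IsProbabilityMeasure ((haarOrth n).map (· * h)) :=
    Measure.isProbabilityMeasure_map (by fun_prop)
  exact Measure.isHaarMeasure_eq_of_isProbabilityMeasure _ _

theorem measurable_orth_apply (n : ℕ) :
    Measurable fun p : Orth n × Euc n => (p.1 : Euc n →L[ℝ] Euc n) p.2 := by
  refine Continuous.measurable ?_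
  fun_prop

/-- A linear isometry defined on a subspace of `ℝⁿ` is the restriction of an orthogonal map. -/
theorem exists_orth_extend {n : ℕ} {S : Submodule ℝ (Euc n)} (L : S →ₗᵢ[ℝ] Euc n) :
    ∃ g : Orth n, ∀ s : S, (g : Euc n →L[ℝ] Euc n) s = L s := by
  refine ⟨Unitary.linearIsometryEquiv.symm (L.extend.toLinearIsometryEquiv rfl), fun s => ?_⟩
  exact L.extend_apply s

theorem exists_orth_apply_eq {n : ℕ} {x y : Euc n} (h : ‖x‖ = ‖y‖) :
    ∃ g : Orth n, (g : Euc n →L[ℝ] Euc n) x = y := by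
  by_cases hx : x = 0
  · refine ⟨1, ?_⟩
    have : y = 0 := by rw [← norm_eq_zero, ← h, hx, norm_zero]
    simp [hx, this]
  -- The map `c • x ↦ c • y` on the line through `x` is isometric because the norms agree; it is
  -- then extended to the whole space.
  have key : ∀ s : Submodule.span ℝ {x}, ∀ c : ℝ, (s : Euc n) = c • x →
      (LinearMap.toSpanSingleton ℝ (Euc n) y ∘ₗ
        (LinearEquiv.toSpanNonzeroSingleton ℝ (Euc n) x hx).symm.toLinearMap) s = c • y := by
    intro s c hs
    have : s = LinearEquiv.toSpanNonzeroSingleton ℝ (Euc n) x hx c := Subtype.ext hs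
    rw [this, LinearMap.comp_apply, LinearEquiv.coe_coe, LinearEquiv.symm_apply_apply,
      LinearMap.toSpanSingleton_apply]
  obtain ⟨g, hg⟩ := exists_orth_extend (S := Submodule.span ℝ {x})
    { toLinearMap := LinearMap.toSpanSingleton ℝ (Euc n) y ∘ₗ
        (LinearEquiv.toSpanNonzeroSingleton ℝ (Euc n) x hx).symm.toLinearMap
      norm_map' := fun s => by
        obtain ⟨c, hc⟩ := Submodule.mem_span_singleton.mp s.2
        rw [key s c hc.symm, norm_smul, ← h, ← norm_smul, hc]; rfl }
  refine ⟨g, ?_⟩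
  have := hg ⟨x, Submodule.mem_span_singleton_self x⟩
  rw [this]
  exact (key _ 1 (by simp)).trans (one_smul _ _)

/-- A linear isometry from `ℝᵐ` onto a given `m`-dimensional subspace. -/
noncomputable def Gr.param {m n : ℕ} (W : Gr m n) : Euc m ≃ₗᵢ[ℝ] W.1 :=
  ((stdOrthonormalBasis ℝ W.1).reindex (finCongr W.2)).repr.symm

theorem Gr.norm_param {m n : ℕ} (W : Gr m n) (y : Euc m) : ‖(W.param y : Euc n)‖ = ‖y‖ :=
  W.param.norm_map y

theorem rotate_surjective {m n : ℕ} (W : Gr m n) :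
    Function.Surjective fun g : Orth n => rotate g W := by
  intro V
  obtain ⟨g, hg⟩ := exists_orth_extend
    (V.1.subtypeₗᵢ.comp (W.param.symm.trans V.param).toLinearIsometry)
  refine ⟨g, Subtype.ext ?_⟩
  refine Submodule.eq_of_le_of_finrank_eq ?_ ((rotate g W).2.trans V.2.symm)
  rintro _ ⟨w, hw, rfl⟩
  have := hg ⟨w, hw⟩
  change (g : Euc n →L[ℝ] Euc n) w ∈ V.1
  rw [this]
  exact Subtype.mem _

instance (m n : ℕ) : MeasurableSpace.CountablySeparated (Gr m n) := by
  have hinj : Function.Injective fun W : Gr m n => W.1.starProjection := fun V W h =>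
    Subtype.ext (Submodule.starProjection_inj.mp h)
  have : MeasurableSpace.CountablyGenerated (Gr m n) := MeasurableSpace.CountablyGenerated.comap _
  have : MeasurableSpace.SeparatesPoints (Gr m n) := ⟨fun V W h => hinj <|
    MeasurableSpace.separatesPoints_def fun s hs => h _ ⟨s, hs, rfl⟩⟩
  infer_instance

/-! ### Sections and hitting probabilities -/

theorem sectionVolume_rotate {m n : ℕ} (K : Set (Euc n)) (g : Orth n) (W : Gr m n) :
    sectionVolume K (rotate g W) =
      volume {y : Euc m | (g : Euc n →L[ℝ] Euc n) (W.param y : Euc n) ∈ K} := by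
  let e : Euc m ≃ₗᵢ[ℝ] (rotate g W).1 :=
    W.param.trans ((Unitary.linearIsometryEquiv g).submoduleMap W.1)
  exact (e.measurePreserving.measure_preimage_equiv (f := e.toMeasurableEquiv)
    {w : (rotate g W).1 | (w : Euc n) ∈ K}).symm

theorem measurableSet_orth_apply {n k : ℕ} {K : Set (Euc n)} (hK : MeasurableSet K)
    {ψ : Euc k → Euc n} (hψ : Measurable ψ) :
    MeasurableSet {p : Orth n × Euc k | (p.1 : Euc n →L[ℝ] Euc n) (ψ p.2) ∈ K} :=
  ((measurable_orth_apply n).comp (measurable_fst.prodMk (hψ.comp measurable_snd))) hK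

theorem measurable_sectionVolume {m n : ℕ} {K : Set (Euc n)} (hK : MeasurableSet K) :
    Measurable (sectionVolume (m := m) K) := by
  by_cases h : Nonempty (Gr m n)
  · obtain ⟨W⟩ := h
    -- A measurable surjection from a Polish space onto a countably separated space detects
    -- measurability, so it can be tested on the orthogonal group.
    rw [← (measurable_orbit W).measurable_comp_iff_of_surjective (rotate_surjective W)]
    simp only [Function.comp_def, sectionVolume_rotate]
    exact measurable_measure_prodMk_left (ν := volume) (measurableSet_orth_apply hK
      (ψ := fun y => (W.param y : Euc n)) (by fun_prop))
  · have := not_nonempty_iff.mp h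
    exact measurable_of_empty _

/-- The probability that a uniformly random rotation moves `x` into `K`. -/
noncomputable def hitProb {n : ℕ} (K : Set (Euc n)) (x : Euc n) : ENNReal :=
  haarOrth n {g | (g : Euc n →L[ℝ] Euc n) x ∈ K}

theorem measurable_hitProb {n : ℕ} {K : Set (Euc n)} (hK : MeasurableSet K) :
    Measurable (hitProb K) :=
  measurable_measure_prodMk_right (μ := haarOrth n)
    (s := {p : Orth n × Euc n | (p.1 : Euc n →L[ℝ] Euc n) p.2 ∈ K})
    (measurableSet_orth_apply (ψ := fun x => x) hK measurable_id)

/-- The orthogonal group is transitive on spheres, and right translation by the `u` with `u x = y`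
preserves Haar measure. -/
theorem hitProb_congr {n : ℕ} (K : Set (Euc n)) {x y : Euc n} (h : ‖x‖ = ‖y‖) :
    hitProb K x = hitProb K y := by
  obtain ⟨u, rfl⟩ := exists_orth_apply_eq h
  exact (measure_preimage_mul_right (haarOrth n) u {g | (g : Euc n →L[ℝ] Euc n) x ∈ K}).symm

theorem thickness_eq_lintegral_hitProb {m n : ℕ} (h : m ≤ n) {K : Set (Euc n)}
    (hK : MeasurableSet K) :
    thickness h K = ∫⁻ y : Euc m, hitProb K ((coordSubspace h).param y : Euc n) := by
  have hm := measurableSet_orth_apply hK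
    (ψ := fun y => ((coordSubspace h).param y : Euc n)) (by fun_prop)
  rw [thickness, uniformGr, lintegral_map (measurable_sectionVolume hK) (measurable_orbit _)]
  simp only [sectionVolume_rotate]
  exact (Measure.prod_apply (μ := haarOrth n) (ν := volume) hm).symm.trans
    (Measure.prod_apply_symm hm)

/-- Each rotation preserves Lebesgue measure and the norm, so the left side equals its own average
over rotations; Tonelli turns the averaged indicator into `hitProb`. -/
theorem setLIntegral_norm_eq_lintegral_hitProb {n : ℕ} {K : Set (Euc n)} (hK : MeasurableSet K)
    {φ : ℝ → ENNReal} (hφ : Measurable φ) :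
    ∫⁻ x in K, φ ‖x‖ = ∫⁻ x, φ ‖x‖ * hitProb K x := by
  have hm := measurableSet_orth_apply hK measurable_id
  have hrot : ∀ g : Orth n, ∫⁻ x, K.indicator (fun x => φ ‖x‖) ((g : Euc n →L[ℝ] Euc n) x) =
      ∫⁻ x in K, φ ‖x‖ := fun g => by
    rw [← lintegral_indicator hK]
    exact (Unitary.linearIsometryEquiv g).measurePreserving.lintegral_comp
      (Measurable.indicator (by fun_prop) hK)
  calc
    ∫⁻ x in K, φ ‖x‖ = ∫⁻ g, ∫⁻ x, K.indicator (fun x => φ ‖x‖) ((g : Euc n →L[ℝ] Euc n) x)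
        ∂volume ∂haarOrth n := by
      simp only [hrot, lintegral_const, measure_univ, mul_one]
    _ = ∫⁻ x, ∫⁻ g, K.indicator (fun x => φ ‖x‖) ((g : Euc n →L[ℝ] Euc n) x)
        ∂haarOrth n := by
      refine lintegral_lintegral_swap (Measurable.aemeasurable ?_)
      exact (Measurable.indicator (by fun_prop) hK).comp (measurable_orth_apply n)
    _ = _ := by
      refine lintegral_congr fun x => ?_
      have hs : MeasurableSet {g : Orth n | (g : Euc n →L[ℝ] Euc n) x ∈ K} :=
        measurable_prodMk_right hm
      rw [hitProb, ← lintegral_indicator_const hs]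
      refine lintegral_congr fun g => ?_
      have hg : ‖(g : Euc n →L[ℝ] Euc n) x‖ = ‖x‖ := Unitary.norm_map g x
      simp only [indicator, mem_ofPred_eq, hg]

/-! ### The thickness formula for Borel sets -/

theorem sphereArea_eq (n : ℕ) : sphereArea n = n * ballVol n := by
  rw [sphereArea, solidAngle, Measure.toSphere_apply_univ, finrank_euclideanSpace_fin, ballVol]

theorem sphereArea_ne_top (n : ℕ) : sphereArea n ≠ ⊤ :=
  measure_ne_top (Measure.toSphere volume) _

theorem sphereArea_ne_zero {n : ℕ} (hn : 1 ≤ n) : sphereArea n ≠ 0 := by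
  rw [sphereArea_eq]
  exact mul_ne_zero (by exact_mod_cast (by lia : n ≠ 0))
    (Metric.isOpen_ball.measure_ne_zero _ (by simp))

theorem nontrivial_euc {n : ℕ} (hn : 1 ≤ n) : Nontrivial (Euc n) :=
  Module.nontrivial_of_finrank_pos (R := ℝ) (by rw [finrank_euclideanSpace_fin]; exact hn)

theorem pow_pred_mul_zpow {m n : ℕ} (hm : 1 ≤ m) (hmn : m ≤ n) {r : ℝ} (hr : 0 < r) :
    r ^ (n - 1) * r ^ ((m : ℤ) - (n : ℤ)) = r ^ (m - 1) := by
  rw [← zpow_natCast, ← zpow_natCast, ← zpow_add₀ hr.ne']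
  congr 1
  lia

theorem thickness_of_measurableSet {m n : ℕ} (hm : 1 ≤ m) (hmn : m ≤ n) {K : Set (Euc n)}
    (hK : MeasurableSet K) :
    thickness hmn K = m * ballVol m / sphereArea n *
      ∫⁻ x in K, ENNReal.ofReal (‖x‖ ^ ((m : ℤ) - (n : ℤ))) := by
  have := nontrivial_euc hm
  have := nontrivial_euc (hm.trans hmn)
  obtain ⟨e, he⟩ := exists_norm_eq (Euc n) zero_le_one
  set φ : ℝ → ENNReal := fun r => hitProb K (r • e) with hφ
  have hφm : Measurable φ := (measurable_hitProb hK).comp (by fun_prop)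
  have hφK : ∀ x, hitProb K x = φ ‖x‖ := fun x => hitProb_congr K (by simp [norm_smul, he])
  have hpow : Measurable fun r : ℝ => ENNReal.ofReal (r ^ ((m : ℤ) - (n : ℤ))) := by fun_prop
  have h1 : thickness hmn K = sphereArea m *
      ∫⁻ r in Ioi (0 : ℝ), ENNReal.ofReal (r ^ (m - 1)) * φ r := by
    rw [thickness_eq_lintegral_hitProb hmn hK]
    simp only [hφK, Gr.norm_param]
    rw [lintegral_fun_norm volume hφm, finrank_euclideanSpace_fin]
    rfl
  have h2 : ∫⁻ x in K, ENNReal.ofReal (‖x‖ ^ ((m : ℤ) - (n : ℤ))) = sphereArea n *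
      ∫⁻ r in Ioi (0 : ℝ), ENNReal.ofReal (r ^ (m - 1)) * φ r := by
    rw [setLIntegral_norm_eq_lintegral_hitProb hK hpow]
    simp only [hφK]
    refine (lintegral_fun_norm volume (hpow.mul hφm)).trans ?_
    rw [finrank_euclideanSpace_fin]
    congr 1
    refine setLIntegral_congr_fun measurableSet_Ioi fun r hr => ?_
    simp only [Pi.mul_apply]
    rw [← mul_assoc, ← ENNReal.ofReal_mul (pow_nonneg (le_of_lt hr) _),
      pow_pred_mul_zpow hm hmn hr]
  rw [h1, h2, ← mul_assoc, ENNReal.div_mul_cancel (sphereArea_ne_zero (hm.trans hmn))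
    (sphereArea_ne_top n), sphereArea_eq]

/-! ### Null sets and Lebesgue measurable sets -/

theorem sectionVolume_ae_eq_zero {m n : ℕ} (hm : 1 ≤ m) (hmn : m ≤ n) {N : Set (Euc n)}
    (hN : volume N = 0) : sectionVolume N =ᵐ[uniformGr hmn] 0 := by
  have hM := measurableSet_toMeasurable volume N
  -- The Borel formula applies to a measurable null hull, whose sections dominate those of `N`.
  have h0 : thickness hmn (toMeasurable volume N) = 0 := by
    rw [thickness_of_measurableSet hm hmn hM,
      setLIntegral_measure_zero _ _ ((measure_toMeasurable N).trans hN), mul_zero]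
  rw [thickness, lintegral_eq_zero_iff (measurable_sectionVolume hM)] at h0
  filter_upwards [h0] with W hW
  exact measure_mono_null (fun w hw => subset_toMeasurable volume N hw) hW

theorem sectionVolume_congr_ae {m n : ℕ} (hm : 1 ≤ m) (hmn : m ≤ n) {K L : Set (Euc n)}
    (h : K =ᵐ[volume] L) : sectionVolume K =ᵐ[uniformGr hmn] sectionVolume L := by
  obtain ⟨h1, h2⟩ := ae_eq_set.mp h
  filter_upwards [sectionVolume_ae_eq_zero hm hmn h1, sectionVolume_ae_eq_zero hm hmn h2]
    with W hW1 hW2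
  exact measure_congr (ae_eq_set.mpr ⟨hW1, hW2⟩)

theorem aemeasurable_sectionVolume {m n : ℕ} (hm : 1 ≤ m) (hmn : m ≤ n) {K : Set (Euc n)}
    (hK : NullMeasurableSet K volume) :
    AEMeasurable (sectionVolume (m := m) K) (uniformGr hmn) :=
  ⟨_, measurable_sectionVolume (measurableSet_toMeasurable volume K),
    sectionVolume_congr_ae hm hmn hK.toMeasurable_ae_eq.symm⟩

theorem thickness_of_nullMeasurableSet {m n : ℕ} (hm : 1 ≤ m) (hmn : m ≤ n) {K : Set (Euc n)}
    (hK : NullMeasurableSet K volume) :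
    thickness hmn K = m * ballVol m / sphereArea n *
      ∫⁻ x in K, ENNReal.ofReal (‖x‖ ^ ((m : ℤ) - (n : ℤ))) := by
  have h := hK.toMeasurable_ae_eq
  rw [← setLIntegral_congr h,
    ← thickness_of_measurableSet hm hmn (measurableSet_toMeasurable volume K)]
  exact lintegral_congr_ae (sectionVolume_congr_ae hm hmn h.symm)

/-! ### Star-shaped regions -/

theorem smul_mem_starRegion_iff {n : ℕ} {f : USphere n → ℝ} {r : ℝ} (hr : 0 < r) (u : USphere n) :
    r • (u : Euc n) ∈ starRegion f ↔ r ≤ f u := by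
  refine ⟨?_, fun h => ⟨u, r, hr.le, h, rfl⟩⟩
  rintro ⟨v, s, hs, hsv, h⟩
  have hu : ‖(u : Euc n)‖ = 1 := by simp
  have hv : ‖(v : Euc n)‖ = 1 := by simp
  have hrs : r = s := by
    have := congrArg norm h
    rwa [norm_smul, norm_smul, hu, hv, mul_one, mul_one, Real.norm_of_nonneg hr.le,
      Real.norm_of_nonneg hs] at this
  subst hrs
  rwa [Subtype.ext (smul_right_injective (Euc n) hr.ne' h)]

theorem nullMeasurableSet_starRegion {n : ℕ} (hn : 1 ≤ n) {f : USphere n → ℝ}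
    (hf : AEMeasurable f (solidAngle n)) : NullMeasurableSet (starRegion f) volume := by
  have := nontrivial_euc hn
  have hmp := (volume : Measure (Euc n)).measurePreserving_homeomorphUnitSphereProd
  have hS : NullMeasurableSet {p : USphere n × Ioi (0 : ℝ) | (p.2 : ℝ) ≤ f p.1}
      ((solidAngle n).prod (Measure.volumeIoiPow (Module.finrank ℝ (Euc n) - 1))) :=
    nullMeasurableSet_le (measurable_subtype_coe.comp measurable_snd).aemeasurable
      (hf.comp_quasiMeasurePreserving Measure.quasiMeasurePreserving_fst)
  -- Polar coordinates omit the origin, which is a null set because `n ≥ 1`.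
  have himg : Subtype.val '' (homeomorphUnitSphereProd (Euc n) ⁻¹'
      {p : USphere n × Ioi (0 : ℝ) | (p.2 : ℝ) ≤ f p.1}) = starRegion f \ {0} := by
    ext x
    by_cases hx0 : x = 0
    · simp [hx0]
    have hx : 0 < ‖x‖ := norm_pos_iff.mpr hx0
    have hpolar : x = ‖x‖ • ((homeomorphUnitSphereProd (Euc n) ⟨x, hx0⟩).1 : Euc n) := by
      simp [smul_smul, hx.ne']
    have hmem : x ∈ starRegion f ↔ ‖x‖ ≤ f (homeomorphUnitSphereProd (Euc n) ⟨x, hx0⟩).1 := by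
      rw [← smul_mem_starRegion_iff hx, ← hpolar]
    simp only [mem_sdiff, hmem, mem_singleton_iff, hx0, not_false_eq_true, and_true]
    rw [← homeomorphUnitSphereProd_apply_snd_coe (Euc n) ⟨x, hx0⟩]
    exact ⟨by rintro ⟨y, hy, rfl⟩; exact hy, fun h => ⟨⟨x, hx0⟩, h, rfl⟩⟩
  have hdiff := Measure.NullMeasurableSet.subtype_coe
    (measurableSet_singleton (0 : Euc n)).compl.nullMeasurableSet
    (hS.preimage hmp.quasiMeasurePreserving)
  rw [himg] at hdiff
  exact hdiff.congr (sdiff_null_ae_eq_self (measure_singleton 0))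

theorem setLIntegral_starRegion {m n : ℕ} (hm : 1 ≤ m) (hmn : m ≤ n) {f : USphere n → ℝ}
    (h0 : ∀ u, 0 ≤ f u) (hf : AEMeasurable f (solidAngle n)) :
    m * ∫⁻ x in starRegion f, ENNReal.ofReal (‖x‖ ^ ((m : ℤ) - (n : ℤ))) =
      ∫⁻ u, ENNReal.ofReal (f u ^ m) ∂(solidAngle n) := by
  have := nontrivial_euc (hm.trans hmn)
  have hK := nullMeasurableSet_starRegion (hm.trans hmn) hf
  rw [← lintegral_indicator₀ hK, lintegral_eq_lintegral_toSphere volume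
    (AEMeasurable.indicator₀ (by fun_prop) hK), finrank_euclideanSpace_fin,
    ← lintegral_const_mul' _ _ (ENNReal.natCast_ne_top m)]
  refine lintegral_congr fun u => ?_
  have hu : ‖(u : Euc n)‖ = 1 := by simp
  have h1 : ∀ r ∈ Ioi (0 : ℝ), ENNReal.ofReal (r ^ (n - 1)) * (starRegion f).indicator
      (fun x => ENNReal.ofReal (‖x‖ ^ ((m : ℤ) - (n : ℤ)))) (r • (u : Euc n)) =
      (Iic (f u)).indicator (fun r => ENNReal.ofReal (r ^ (m - 1))) r := fun r hr => by
    by_cases hru : r ≤ f u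
    · rw [indicator_of_mem ((smul_mem_starRegion_iff hr u).mpr hru),
        indicator_of_mem (mem_Iic.mpr hru), norm_smul, hu, mul_one,
        Real.norm_of_nonneg (le_of_lt hr), ← ENNReal.ofReal_mul (pow_nonneg (le_of_lt hr) _), pow_pred_mul_zpow hm hmn hr]
    · rw [indicator_of_notMem (fun h => hru ((smul_mem_starRegion_iff hr u).mp h)),
        indicator_of_notMem (by exact hru), mul_zero]
  rw [setLIntegral_congr_fun measurableSet_Ioi h1, lintegral_indicator measurableSet_Iic,
    Measure.restrict_restrict measurableSet_Iic, Iic_inter_Ioi,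
    ← ofReal_integral_eq_lintegral_ofReal (intervalIntegral.intervalIntegrable_pow _).1,
    ← intervalIntegral.integral_of_le (h0 u), integral_pow, ← ENNReal.ofReal_natCast,
    ← ENNReal.ofReal_mul (Nat.cast_nonneg m)]
  · congr 1
    -- Writing `m = k + 1` removes the truncated subtraction in `m - 1` and makes the lower endpoint
    -- term `0 ^ (k + 1)` vanish.
    obtain ⟨k, rfl⟩ := Nat.exists_eq_add_of_le' hm
    simp
    field_simp
  · filter_upwards [ae_restrict_mem measurableSet_Ioc] with r hr
    exact pow_nonneg hr.1.le _

end AverageSection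

theorem mainTheorem3 (m n : ℕ) (hm : 1 ≤ m) (hmn : m ≤ n) :
    (∀ f : AverageSection.USphere n → ℝ, (∀ u, 0 ≤ f u) →
      AEMeasurable f (AverageSection.solidAngle n) →
      AEMeasurable (AverageSection.sectionVolume (m := m) (AverageSection.starRegion f))
          (AverageSection.uniformGr hmn) ∧
        AverageSection.thickness hmn (AverageSection.starRegion f) =
          AverageSection.ballVol m / AverageSection.sphereArea n *
            ∫⁻ u, ENNReal.ofReal (f u ^ m) ∂(AverageSection.solidAngle n)) ∧
    (∀ K : Set (AverageSection.Euc n), NullMeasurableSet K volume →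
      AEMeasurable (AverageSection.sectionVolume (m := m) K) (AverageSection.uniformGr hmn) ∧
        AverageSection.thickness hmn K =
          m * AverageSection.ballVol m / AverageSection.sphereArea n *
            ∫⁻ x in K, ENNReal.ofReal (‖x‖ ^ ((m : ℤ) - (n : ℤ))) ∧
        AverageSection.thickness hmn K =
          (volume : Measure (AverageSection.Euc n)).withDensity
            (fun x => m * AverageSection.ballVol m / AverageSection.sphereArea n *
              ENNReal.ofReal (‖x‖ ^ ((m : ℤ) - (n : ℤ)))) K) := by
  refine ⟨fun f h0 hf => ?_, fun K hK => ⟨AverageSection.aemeasurable_sectionVolume hm hmn hK,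
    AverageSection.thickness_of_nullMeasurableSet hm hmn hK, ?_⟩⟩
  · have hK := AverageSection.nullMeasurableSet_starRegion (hm.trans hmn) hf
    refine ⟨AverageSection.aemeasurable_sectionVolume hm hmn hK, ?_⟩
    rw [AverageSection.thickness_of_nullMeasurableSet hm hmn hK,
      ← AverageSection.setLIntegral_starRegion hm hmn h0 hf, ← mul_assoc,
      mul_comm (m : ENNReal), ENNReal.mul_div_right_comm]
  · rw [withDensity_apply₀ _ hK, lintegral_const_mul _ (by fun_prop),
      AverageSection.thickness_of_nullMeasurableSet hm hmn hK]
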